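/- A company is a finite rooted tree $T_0$ with $n_0$ vertices (the positions); the root is the boss. The departments of the company are the connected components of $T_0$ with the root removed. Consider the following Markov chains on the rooted subtrees of $T_0$ (the connected sets of vertices containing the root), started at $T_0$. For a rooted subtree $T$ write $n$ for its number of vertices and $n^{(i)}$ for the number of its vertices in department $i$; write $T_t$ for the state after $t$ months, and $n_t$, $n_t^{(i)}$ for the corresponding numbers. Firing an employee leaves his position vacant. As long as there are employees further down the chain of superiority (strict descendants) from the vacant position, one of them, chosen uniformly, is promoted to it, and his former position becomes vacant; when there are none, the vacant position is deleted from the tree. Nobody is fired when only the boss remains. - Single model: each month, with probability $n/n_0$, one employee, chosen uniformly from all $n$ employees, is fired; otherwise nothing changes. - Binomial model, with parameter $q_2\in[0,1]$: each month, every employee (including the boss) independently performs badly with probability $1-q_2$, and all those who do are fired one by one in a uniformly random order. Let $s_i$, one for each department $i$, be nonnegative integers, not all zero. Let $\beta=\frac{n_0-1-\sum_i s_i}{n_0}$ for the single model and $\beta=q_2^{1+\sum_i s_i}$ for the binomial model. Then the following hold. (i) In each of the two models, with transition matrix $K$, the function $\mathbf f(T):=n\prod_i\binom{n^{(i)}}{s_i}$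 satisfies $\sum_{T'}K(T,T')\,\mathbf f(T')=\beta\,\mathbf f(T)$ for all rooted subtrees $T$; and $\mathbf f$ is not identically zero (hence is a right eigenfunction of eigenvalue $\beta$) if and only if $s_i\le n_0^{(i)}$ for all $i$. (ii) In each of the two models, for all integers $t\ge 0$, $$\mathbb E\Big(n_t\prod_i\binom{n_t^{(i)}}{s_i}\Big)=\beta^t\,n_0\prod_i\binom{n_0^{(i)}}{s_i}.$$ (iii) In each of the two models, for all integers $t\ge 0$, $$\beta^t\prod_i\binom{n_0^{(i)}}{s_i}\le\mathbb E\Big(\prod_i\binom{n_t^{(i)}}{s_i}\Big)\le\beta^t\,\frac{n_0}{1+\sum_i s_i}\prod_i\binom{n_0^{(i)}}{s_i}.$$ Moreover, in the single model, for all integers $0\le t<n_0$, $$\mathbb E\Big(\prod_i\binom{n_t^{(i)}}{s_i}\Big)\le\beta^t\,\frac{n_0}{n_0-t}\prod_i\binom{n_0^{(i)}}{s_i}.$$ -/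

import Mathlib

open scoped ENNReal unitInterval

/-!
A company structure is a finite rooted tree, given by Mathlib's `RootedTree`: the order is
`v ≤ w` iff `v` is an ancestor of `w` or `v = w`, the root (the boss) is `⊥`, and
`Order.pred v` is the parent (direct superior) of `v ≠ ⊥`, with `Order.pred ⊥ = ⊥`.
The vertices of the tree are the positions of the initial company.
-/

namespace Firing

/-! ### Company structures -/

/-- A set of positions is a rooted subtree (a connected set of vertices containing the root) if it
contains the root and, with every vertex, the parent of that vertex. -/
def IsRootedSubtree {T : RootedTree} (S : Finset T) : Prop :=
  ⊥ ∈ S ∧ ∀ v ∈ S, Order.pred v ∈ S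

/-- The state space of the chain started from `T`: the rooted subtrees of `T`. -/
def State (T : RootedTree) : Type _ := {S : Finset T // IsRootedSubtree S}

noncomputable instance instFintypeState (T : RootedTree) [Fintype T] : Fintype (State T) :=
  @Subtype.fintype _ _ (Classical.decPred _) _

/-- The initial state: the whole tree. -/
def State.full (T : RootedTree) [Fintype T] : State T :=
  ⟨Finset.univ, Finset.mem_univ _, fun _ _ => Finset.mem_univ _⟩

/-- The number `n` of employees. -/
def State.size {T : RootedTree} (S : State T) : ℕ := S.1.card

/-- The departments of the initial company: the subtrees hanging at the children of the root. -/
abbrev Department (T : RootedTree) : Type _ := {D : SubRootedTree T // D ∈ T.subtrees}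

noncomputable instance instFintypeDepartment (T : RootedTree) [Fintype T] :
    Fintype (Department T) :=
  @Subtype.fintype _ _ (Classical.decPred _) (inferInstanceAs (Fintype T))

open Classical in
/-- The number `n^{(i)}` of employees of department `i`. -/
noncomputable def State.deptSize {T : RootedTree} (S : State T) (i : Department T) : ℕ :=
  (S.1.filter (fun v => v ∈ i.1)).card

/-- The number of ways to choose a team of `s i` employees from each department `i`. -/
noncomputable def State.teams {T : RootedTree} [Fintype T] (s : Department T → ℕ) (S : State T) :
    ℝ :=
  ∏ i, ((S.deptSize i).choose (s i) : ℝ)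

/-! ### Staffings: who holds which position -/

section Staffings

open Classical

variable {T : RootedTree} [Fintype T]

/-- The positions held by someone, where `pos e = some v` says that employee `e` holds position
`v`, and `pos e = none` that `e` is not in the company.  Employees are named by the elements
of `T`. -/
noncomputable def occupied (pos : T → Option T) : Finset T :=
  Finset.univ.filter (fun v => ∃ e, pos e = some v)

variable (T) in
/-- An assignment of employees to distinct positions, such that the occupied positions form a
rooted subtree. -/
structure Staffing where
  pos : T → Option T
  inj : ∀ e e' v, pos e = some v → pos e' = some v → e = e'
  rooted : IsRootedSubtree (occupied pos)

/-- The company structure of a staffing: it forgets who holds which position. -/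
noncomputable def Staffing.state (ρ : Staffing T) : State T := ⟨occupied ρ.pos, ρ.rooted⟩

variable (T) in
/-- The situation in the middle of a promotion cascade: exactly one position, `spot`, of the company
structure is vacant, and there is at least one employee. -/
structure Vacancy where
  pos : T → Option T
  spot : T
  inj : ∀ e e' v, pos e = some v → pos e' = some v → e = e'
  vacant : ∀ e, pos e ≠ some spot
  staffed : ∃ e v, pos e = some v
  rooted : IsRootedSubtree (insert spot (occupied pos))

/-- The employees further down the chain of superiority from the vacant position. -/
noncomputable def Vacancy.candidates (c : Vacancy T) : Finset T :=
  Finset.univ.filter (fun e => ∃ w, c.pos e = some w ∧ c.spot < w)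

theorem Vacancy.isSome_of_mem (c : Vacancy T) {e : T} (he : e ∈ c.candidates) :
    (c.pos e).isSome = true := by
  simp only [candidates, Finset.mem_filter] at he
  obtain ⟨-, w, hw, -⟩ := he
  simp [hw]

theorem Vacancy.spot_lt_of_mem (c : Vacancy T) {e : T} (he : e ∈ c.candidates) :
    c.spot < (c.pos e).get (c.isSome_of_mem he) := by
  have h := he
  simp only [candidates, Finset.mem_filter] at h
  obtain ⟨-, w, hw, hlt⟩ := h
  simpa [hw] using hlt

theorem exists_update_iff {V : Type*} (pos : V → Option V) (e v x : V) :
    (∃ e', Function.update pos e (some v) e' = some x) ↔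
      x = v ∨ ∃ e', e' ≠ e ∧ pos e' = some x := by
  constructor
  · rintro ⟨e', h⟩
    by_cases hee : e' = e
    · subst hee
      left
      simpa using h.symm
    · right
      exact ⟨e', hee, by simpa [hee] using h⟩
  · rintro (rfl | ⟨e', hee, h⟩)
    · exact ⟨e, by simp⟩
    · exact ⟨e', by simpa [hee] using h⟩

/-- Employee `e`, who is further down from the vacant position, is promoted to it, so that the
former position of `e` becomes vacant. -/
noncomputable def Vacancy.promote (c : Vacancy T) (e : T) (he : e ∈ c.candidates) : Vacancy T where
  pos := Function.update c.pos e (some c.spot)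
  spot := (c.pos e).get (c.isSome_of_mem he)
  inj := by
    intro e₁ e₂ v h₁ h₂
    by_cases k₁ : e₁ = e <;> by_cases k₂ : e₂ = e
    · rw [k₁, k₂]
    · subst k₁
      simp only [Function.update_self, Option.some.injEq] at h₁
      subst h₁
      exact absurd (by simpa [k₂] using h₂) (c.vacant e₂)
    · subst k₂
      simp only [Function.update_self, Option.some.injEq] at h₂
      subst h₂
      exact absurd (by simpa [k₁] using h₁) (c.vacant e₁)
    · exact c.inj e₁ e₂ v (by simpa [k₁] using h₁) (by simpa [k₂] using h₂)
  vacant := by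
    intro e₁ h₁
    by_cases k₁ : e₁ = e
    · subst k₁
      simp only [Function.update_self, Option.some.injEq] at h₁
      exact (c.spot_lt_of_mem he).ne h₁
    · rw [Function.update_of_ne k₁] at h₁
      exact k₁ (c.inj e₁ e _ h₁ (Option.some_get _).symm)
  staffed := ⟨e, c.spot, by simp⟩
  rooted := by
    have key : insert ((c.pos e).get (c.isSome_of_mem he))
        (occupied (Function.update c.pos e (some c.spot))) =
        insert c.spot (occupied c.pos) := by
      obtain ⟨w, hw⟩ := Option.isSome_iff_exists.mp (c.isSome_of_mem he)
      ext x
      simp only [occupied, Finset.mem_insert, Finset.mem_filter, Finset.mem_univ, true_and,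
        exists_update_iff, hw, Option.get_some]
      constructor
      · rintro (rfl | rfl | ⟨e', -, h⟩)
        · exact Or.inr ⟨e, hw⟩
        · exact Or.inl rfl
        · exact Or.inr ⟨e', h⟩
      · rintro (rfl | ⟨e', h⟩)
        · exact Or.inr (Or.inl rfl)
        · by_cases hee : e' = e
          · subst hee
            rw [hw] at h
            exact Or.inl (Option.some.inj h).symm
          · exact Or.inr (Or.inr ⟨e', hee, h⟩)
    rw [key]
    exact c.rooted

/-- If no employee is further down from the vacant position, then that position disappears from the
company structure. -/
noncomputable def Vacancy.close (c : Vacancy T) (hc : ¬ c.candidates.Nonempty) : Staffing T where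
  pos := c.pos
  inj := c.inj
  rooted := by
    have hno : ∀ w ∈ occupied c.pos, ¬ c.spot < w := by
      intro w hw hlt
      simp only [occupied, Finset.mem_filter, Finset.mem_univ, true_and] at hw
      obtain ⟨e, he⟩ := hw
      exact hc ⟨e, by simpa [Vacancy.candidates] using ⟨w, he, hlt⟩⟩
    have hspot : ∀ w ∈ occupied c.pos, w ≠ c.spot := by
      rintro w hw rfl
      simp only [occupied, Finset.mem_filter, Finset.mem_univ, true_and] at hw
      obtain ⟨e, he⟩ := hw
      exact c.vacant e he
    constructor
    · rcases Finset.mem_insert.mp c.rooted.1 with h | h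
      · exfalso
        obtain ⟨e, v, hev⟩ := c.staffed
        have hv : v ∈ occupied c.pos := by
          simpa [occupied] using ⟨e, hev⟩
        exact hno v hv (h ▸ bot_lt_iff_ne_bot.mpr (h ▸ hspot v hv))
      · exact h
    · intro v hv
      rcases Finset.mem_insert.mp (c.rooted.2 v (Finset.mem_insert_of_mem hv)) with h | h
      · exact absurd (lt_of_le_of_ne (h ▸ Order.pred_le v) (hspot v hv).symm) (hno v hv)
      · exact h

/-- The promotion cascade: as long as there are employees further down from the vacant position,
one of them, chosen uniformly, is promoted to it. -/
noncomputable def cascade (c : Vacancy T) : PMF (Staffing T) :=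
  if h : c.candidates.Nonempty then
    (PMF.uniformOfFinset c.candidates.attach (by simpa using h)).bind
      fun e => cascade (c.promote e.1 e.2)
  else PMF.pure (c.close h)
termination_by (Finset.univ.filter (fun w => c.spot < w)).card
decreasing_by
  apply Finset.card_lt_card
  have hlt := c.spot_lt_of_mem e.2
  refine Finset.ssubset_iff_of_subset ?_ |>.mpr
    ⟨(c.pos e.1).get (c.isSome_of_mem e.2), by simpa using hlt,
      fun hw => lt_irrefl _ (Finset.mem_filter.mp hw).2⟩
  intro w hw
  simp only [Finset.mem_filter, Finset.mem_univ, true_and] at hw ⊢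
  exact hlt.trans hw

/-- The vacancy that arises when employee `e` leaves position `v`, some other employee being
present. -/
noncomputable def Staffing.dismiss (ρ : Staffing T) (e v : T) (hev : ρ.pos e = some v)
    (h : 1 < ρ.state.size) : Vacancy T where
  pos := Function.update ρ.pos e none
  spot := v
  inj := by
    intro e₁ e₂ x h₁ h₂
    have k₁ : e₁ ≠ e := by rintro rfl; simp at h₁
    have k₂ : e₂ ≠ e := by rintro rfl; simp at h₂
    exact ρ.inj e₁ e₂ x (by simpa [k₁] using h₁) (by simpa [k₂] using h₂)
  vacant := by
    intro e₁ h₁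
    have k₁ : e₁ ≠ e := by rintro rfl; simp at h₁
    exact k₁ (ρ.inj e₁ e v (by simpa [k₁] using h₁) hev)
  staffed := by
    obtain ⟨x, hx, hxv⟩ := Finset.exists_mem_ne h v
    simp only [Staffing.state, occupied, Finset.mem_filter, Finset.mem_univ, true_and] at hx
    obtain ⟨e', he'⟩ := hx
    have k : e' ≠ e := by
      rintro rfl
      rw [hev] at he'
      exact hxv (Option.some.inj he').symm
    exact ⟨e', x, by simpa [k] using he'⟩
  rooted := by
    have key : insert v (occupied (Function.update ρ.pos e none)) = occupied ρ.pos := by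
      ext x
      simp only [occupied, Finset.mem_insert, Finset.mem_filter, Finset.mem_univ, true_and]
      constructor
      · rintro (rfl | ⟨e', h'⟩)
        · exact ⟨e, hev⟩
        · have k : e' ≠ e := by rintro rfl; simp at h'
          exact ⟨e', by simpa [k] using h'⟩
      · rintro ⟨e', h'⟩
        by_cases k : e' = e
        · subst k
          rw [hev] at h'
          exact Or.inl (Option.some.inj h').symm
        · exact Or.inr ⟨e', by simpa [k] using h'⟩
    rw [key]
    exact ρ.rooted

/-- Employee `e` is fired from the position that he currently holds, and a promotion cascade
follows.  Nobody is fired when only the boss remains. -/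
noncomputable def fire (ρ : Staffing T) (e : T) : PMF (Staffing T) :=
  if h : (∃ v, ρ.pos e = some v) ∧ 1 < ρ.state.size then
    cascade (ρ.dismiss e h.1.choose h.1.choose_spec h.2)
  else PMF.pure ρ

/-- The employees in the finite set `F` are fired one by one, in a uniformly random order. -/
noncomputable def fireAll (F : Finset T) (ρ : Staffing T) : PMF (Staffing T) :=
  if h : F.Nonempty then
    (PMF.uniformOfFinset F.attach (by simpa using h)).bind
      fun e => (fire ρ e.1).bind fun τ => fireAll (F.erase e.1) τ
  else PMF.pure ρ
termination_by F.card
decreasing_by exact Finset.card_erase_lt_of_mem e.2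

/-- At the start of a month, the employee holding position `v` is named `v`: the chain does not
know more than the company structure. -/
noncomputable def State.staffing (S : State T) : Staffing T where
  pos := fun e => if e ∈ S.1 then some e else none
  inj := by
    intro e e' v h h'
    split_ifs at h h'
    rw [Option.some.inj h, Option.some.inj h']
  rooted := by
    have key : occupied (fun e : T => if e ∈ S.1 then some e else none) = S.1 := by
      ext x
      simp [occupied]
    rw [key]
    exact S.2

/-! ### The two Markov chains -/

/-- The distribution on `Bool` that gives `true` the probability `p`. -/
noncomputable def coin (p : I) : PMF Bool :=
  PMF.ofFintype (fun b => if b then ENNReal.ofReal p else ENNReal.ofReal (1 - p)) (by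
    simp [← ENNReal.ofReal_add p.2.1 (sub_nonneg.mpr p.2.2)])

theorem size_ratio_mem (S : State T) : (S.size : ℝ) / (State.full T).size ∈ I := by
  have h : S.size ≤ (State.full T).size := Finset.card_le_card (Finset.subset_univ _)
  have h' : (S.size : ℝ) ≤ (State.full T).size := by exact_mod_cast h
  exact ⟨by positivity, div_le_one_of_le₀ h' (by positivity)⟩

/-- One month of the single model: with probability `n / n₀`, one uniformly chosen employee is
fired; otherwise there is no change. -/
noncomputable def single (S : State T) : PMF (State T) :=
  (coin ⟨(S.size : ℝ) / (State.full T).size, size_ratio_mem S⟩).bind fun b =>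
    if b then
      (PMF.uniformOfFinset S.1 ⟨⊥, S.2.1⟩).bind fun e =>
        (fire S.staffing e).map Staffing.state
    else PMF.pure S

/-- The random subset of `A` that contains every element of `A`, independently, with
probability `p`. -/
noncomputable def randomSubset (p : I) (A : Finset T) : PMF (Finset T) :=
  PMF.ofFinset
    (fun F => if F ⊆ A then
      ENNReal.ofReal p ^ F.card * ENNReal.ofReal (1 - p) ^ (A.card - F.card) else 0)
    A.powerset
    (by
      rw [Finset.sum_congr rfl (fun F hF => if_pos (Finset.mem_powerset.mp hF)),
        Finset.sum_pow_mul_eq_add_pow,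
        ← ENNReal.ofReal_add p.2.1 (sub_nonneg.mpr p.2.2)]
      simp)
    (fun F hF => if_neg (fun h => hF (Finset.mem_powerset.mpr h)))

/-- One month of the binomial model with parameter `q`: every employee, independently, performs
below `1 - q` with probability `1 - q`, and all those who do are fired one by one in a uniformly
random order. -/
noncomputable def binomial (q : I) (S : State T) : PMF (State T) :=
  (randomSubset (unitInterval.symm q) S.1).bind fun F =>
    (fireAll F S.staffing).map Staffing.state

end Staffings

/-! ### Eigenfunctions and expectations -/

/-- The transition matrix of a Markov chain on a finite set, with rows indexed by the current
state. -/
noncomputable def transitionMatrix {Ω : Type*} (K : Ω → PMF Ω) : Matrix Ω Ω ℝ :=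
  Matrix.of fun x y => (K x y).toReal

/-- The distribution after `t` steps of the Markov chain started at `x`. -/
noncomputable def law {Ω : Type*} (K : Ω → PMF Ω) (x : Ω) : ℕ → PMF Ω
  | 0 => PMF.pure x
  | t + 1 => (law K x t).bind K

/-- The expectation of a function under a distribution on a finite set. -/
noncomputable def expect {Ω : Type*} [Fintype Ω] (p : PMF Ω) (g : Ω → ℝ) : ℝ :=
  ∑ x, (p x).toReal * g x

end Firing

/-! The function `weight` counts pairs of an employee and a team. Firing someone outside the boss's
position vacates some `v ≠ ⊥`; whatever the random promotions are, the position finally deleted lies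
at or below `v`, hence in the department of `v` (`mean_teamCount_cascade_of_ne_bot`). If the boss is
fired, the first promotion is uniform among the `n - 1` others, so the department that shrinks is
that of a uniformly random non-boss (`mean_teamCount_cascade_of_eq_bot`).

Let `X` be the sum over non-boss positions `v` of the number of teams left when the department of
`v` loses one member. The teams avoiding `v` are counted, so `X = (n - 1 - ∑ sᵢ) · teams`
(`sum_shrunkTeamCount`). Summed over all fired employees, the new weight is `(n - 1) X` from the
non-bosses plus `X` from the boss, which is `(n - 1 - ∑ sᵢ) · weight` (`sum_mean_weight_fire`). The
factor `n` in the eigenfunction is what makes this close up.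

Iterating, the sum over all sets of `k` fired employees gives `choose (n - 1 - ∑ sᵢ) k · weight`
(`sum_mean_weight_fireAll`), and the binomial theorem yields the eigenvalue of the binomial model.
In the single model, one firing is averaged with the month of no change. The bounds follow from `1 +
∑ sᵢ ≤ n ≤ n₀` wherever a team exists, and from `n ≥ n₀ - t` in the single model. -/

namespace Firing

/-! ### Means of extended nonnegative functions -/

section Mean

variable {α β : Type*}

/-- The mean of a function with values in `[0, ∞]`. -/
noncomputable def mean (p : PMF α) (g : α → ℝ≥0∞) : ℝ≥0∞ := ∑' x, p x * g x

@[simp]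
theorem mean_pure (a : α) (g : α → ℝ≥0∞) : mean (PMF.pure a) g = g a := by
  rw [mean, tsum_eq_single a]
  · simp
  · intro b hb
    simp [hb]

/-- Values in `[0, ∞]` make every interchange of sums legitimate, so no finiteness of the space of
staffings is needed. -/
theorem mean_bind (p : PMF α) (k : α → PMF β) (g : β → ℝ≥0∞) :
    mean (p.bind k) g = mean p fun x => mean (k x) g := by
  simp only [mean, PMF.bind_apply, ← ENNReal.tsum_mul_left, ← ENNReal.tsum_mul_right]
  rw [ENNReal.tsum_comm]
  simp only [mul_assoc]

theorem mean_map (p : PMF α) (h : α → β) (g : β → ℝ≥0∞) :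
    mean (p.map h) g = mean p fun x => g (h x) := by
  rw [← PMF.bind_pure_comp, mean_bind]
  simp

theorem mean_congr {p : PMF α} {g g' : α → ℝ≥0∞} (h : ∀ x ∈ p.support, g x = g' x) :
    mean p g = mean p g' := by
  refine tsum_congr fun x => ?_
  by_cases hx : x ∈ p.support
  · rw [h x hx]
  · rw [PMF.mem_support_iff, not_not] at hx
    simp [hx]

theorem mean_const (p : PMF α) (a : ℝ≥0∞) : mean p (fun _ => a) = a := by
  rw [mean, ENNReal.tsum_mul_right, p.tsum_coe, one_mul]

theorem mean_mul_left (p : PMF α) (a : ℝ≥0∞) (g : α → ℝ≥0∞) :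
    mean p (fun x => a * g x) = a * mean p g := by
  simp only [mean, ← ENNReal.tsum_mul_left, mul_left_comm]

theorem mean_sum {ι : Type*} (p : PMF α) (s : Finset ι) (g : ι → α → ℝ≥0∞) :
    mean p (fun x => ∑ i ∈ s, g i x) = ∑ i ∈ s, mean p (g i) := by
  simp only [mean, Finset.mul_sum]
  exact Summable.tsum_finsetSum fun _ _ => ENNReal.summable

/-- Multiplying by the cardinality keeps the later counting identities free of division. -/
theorem mean_uniformOfFinset (s : Finset α) (hs : s.Nonempty) (g : α → ℝ≥0∞) :
    (s.card : ℝ≥0∞) * mean (PMF.uniformOfFinset s hs) g = ∑ x ∈ s, g x := by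
  have h0 : (s.card : ℝ≥0∞) ≠ 0 := by simpa using hs.ne_empty
  rw [mean, tsum_eq_sum (s := s), Finset.mul_sum]
  · refine Finset.sum_congr rfl fun x hx => ?_
    rw [PMF.uniformOfFinset_apply_of_mem hs hx, ← mul_assoc,
      ENNReal.mul_inv_cancel h0 (ENNReal.natCast_ne_top _), one_mul]
  · intro b hb
    rw [PMF.uniformOfFinset_apply_of_notMem hs hb, zero_mul]

/-- Natural values keep each term finite, so means computed in `[0, ∞]` transfer to real
expectations. -/
theorem expect_eq_toReal_mean [Fintype α] (p : PMF α) (g : α → ℕ) :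
    expect p (fun x => (g x : ℝ)) = (mean p fun x => (g x : ℝ≥0∞)).toReal := by
  rw [expect, mean, tsum_fintype, ENNReal.toReal_sum]
  · simp
  · exact fun x _ => ENNReal.mul_ne_top (p.apply_ne_top x) (ENNReal.natCast_ne_top _)

end Mean

/-! ### Expectations along a Markov chain -/

section Chain

variable {Ω : Type*} [Fintype Ω]

theorem expect_mono {p : PMF Ω} {g g' : Ω → ℝ} (h : ∀ x ∈ p.support, g x ≤ g' x) :
    expect p g ≤ expect p g' := by
  refine Finset.sum_le_sum fun x _ => ?_
  by_cases hx : x ∈ p.support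
  · exact mul_le_mul_of_nonneg_left (h x hx) ENNReal.toReal_nonneg
  · rw [PMF.mem_support_iff, not_not] at hx
    simp [hx]

theorem expect_const_mul (p : PMF Ω) (a : ℝ) (g : Ω → ℝ) :
    expect p (fun x => a * g x) = a * expect p g := by
  simp only [expect, Finset.mul_sum, mul_left_comm]

theorem expect_pure (a : Ω) (g : Ω → ℝ) : expect (PMF.pure a) g = g a := by
  classical
  rw [expect, Finset.sum_eq_single a]
  · simp
  · intro b _ hb
    simp [hb]
  · simp

theorem expect_bind (p : PMF Ω) (k : Ω → PMF Ω) (g : Ω → ℝ) :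
    expect (p.bind k) g = expect p fun x => expect (k x) g := by
  have h (y : Ω) : (p.bind k y).toReal = ∑ x, (p x).toReal * (k x y).toReal := by
    rw [PMF.bind_apply, tsum_fintype, ENNReal.toReal_sum]
    · simp
    · exact fun x _ => ENNReal.mul_ne_top (p.apply_ne_top x) ((k x).apply_ne_top y)
  simp only [expect, h, Finset.mul_sum, Finset.sum_mul]
  rw [Finset.sum_comm]
  simp only [mul_assoc]

/-- The expectation of an eigenfunction decays geometrically. -/
theorem expect_law_of_eigen {K : Ω → PMF Ω} {g : Ω → ℝ} {β : ℝ}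
    (h : ∀ x, expect (K x) g = β * g x) (x : Ω) (t : ℕ) :
    expect (law K x t) g = β ^ t * g x := by
  induction t with
  | zero => simp [law, expect_pure]
  | succ t ih =>
    rw [law, expect_bind]
    simp only [h]
    rw [expect_const_mul, ih]
    ring

end Chain

/-! ### Departments and teams -/

section Teams

open Classical

variable {T : RootedTree}

theorem existsUnique_department {v : T} (hv : v ≠ ⊥) : ∃! i : Department T, v ∈ i.1 := by
  refine ⟨⟨T.subtreeOf v, RootedTree.subtreeOf_mem_subtrees hv⟩, RootedTree.mem_subtreeOf, ?_⟩
  rintro ⟨j, hj⟩ hvj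
  refine Subtype.ext ?_
  by_contra hne
  have := (RootedTree.mem_subtrees_disjoint_iff hj (RootedTree.subtreeOf_mem_subtrees hv) v v hvj
    RootedTree.mem_subtreeOf).mpr hne
  exact hv (disjoint_self.mp this)

theorem bot_notMem_department (i : Department T) : (⊥ : T) ∉ i.1 := by
  rw [SubRootedTree.bot_mem_iff]
  exact i.1.root_ne_bot_of_mem_subtrees i.2

/-- A position lies in the same department as its superiors other than the boss. -/
theorem mem_department_iff_of_le {v w : T} (hv : v ≠ ⊥) (hvw : v ≤ w) (i : Department T) :
    w ∈ i.1 ↔ v ∈ i.1 := by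
  have key (j : Department T) (h : v ∈ j.1) : w ∈ j.1 := h.trans hvw
  refine ⟨fun h => ?_, key i⟩
  obtain ⟨j, hj, -⟩ := existsUnique_department hv
  have hw : w ≠ ⊥ := fun h0 => hv (le_bot_iff.mp (h0 ▸ hvw))
  rwa [(existsUnique_department hw).unique h (key j hj)]

theorem size_pos (S : State T) : 0 < S.size := Finset.card_pos.mpr ⟨⊥, S.2.1⟩

variable [Fintype T]

theorem sum_departments {M : Type*} [AddCommMonoid M] (S : State T) (h : T → M) :
    ∑ i : Department T, ∑ v ∈ S.1.filter (fun v => v ∈ i.1), h v = ∑ v ∈ S.1.erase ⊥, h v := by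
  simp only [Finset.sum_filter]
  rw [Finset.sum_comm, ← Finset.add_sum_erase _ _ S.2.1]
  have hbot : ∑ i : Department T, (if (⊥ : T) ∈ i.1 then h ⊥ else 0) = 0 :=
    Finset.sum_eq_zero fun i _ => if_neg (bot_notMem_department i)
  rw [hbot, zero_add]
  refine Finset.sum_congr rfl fun v hv => ?_
  obtain ⟨i, hi, hu⟩ := existsUnique_department (Finset.ne_of_mem_erase hv)
  rw [Finset.sum_eq_single i, if_pos hi]
  · intro j _ hj
    exact if_neg fun h' => hj (hu j h')
  · simp

theorem sum_deptSize (S : State T) : ∑ i, S.deptSize i = S.size - 1 := by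
  have h := sum_departments S fun _ => 1
  simp only [Finset.sum_const, smul_eq_mul, mul_one] at h
  rw [Finset.card_erase_of_mem S.2.1] at h
  exact h

/-- The number of teams, as a natural number. -/
noncomputable def State.teamCount (s : Department T → ℕ) (S : State T) : ℕ :=
  ∏ i, (S.deptSize i).choose (s i)

/-- The number of teams when the department of position `v` shrinks by one. -/
noncomputable def State.shrunkTeamCount (s : Department T → ℕ) (S : State T) (v : T) : ℕ :=
  ∏ i, (S.deptSize i - if v ∈ i.1 then 1 else 0).choose (s i)

/-- The number of pairs of an employee and a team. -/
noncomputable def State.weight (s : Department T → ℕ) (S : State T) : ℕ :=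
  S.size * S.teamCount s

theorem teams_eq_teamCount (s : Department T → ℕ) (S : State T) :
    S.teams s = (S.teamCount s : ℝ) := by
  simp [State.teams, State.teamCount]

theorem teamCount_ne_zero_iff (s : Department T → ℕ) (S : State T) :
    S.teamCount s ≠ 0 ↔ ∀ i, s i ≤ S.deptSize i := by
  simp [State.teamCount, Finset.prod_eq_zero_iff, Nat.choose_eq_zero_iff]

theorem sum_lt_size_of_teamCount_ne_zero {s : Department T → ℕ} {S : State T}
    (h : S.teamCount s ≠ 0) : 1 + ∑ i, s i ≤ S.size := by
  have h1 : ∑ i, s i ≤ ∑ i, S.deptSize i :=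
    Finset.sum_le_sum fun i _ => (teamCount_ne_zero_iff s S).mp h i
  have := sum_deptSize S
  have := size_pos S
  omega

/-- This is where `s ≠ 0` matters: a lone boss is never fired, so the decay can hold there only
because the weight vanishes. -/
theorem teamCount_eq_zero_of_size_le_one {s : Department T → ℕ} (hs : s ≠ 0) {S : State T}
    (h : S.size ≤ 1) : S.teamCount s = 0 := by
  by_contra h0
  have h1 := sum_lt_size_of_teamCount_ne_zero h0
  refine hs (funext fun i => ?_)
  have := Finset.single_le_sum (f := s) (fun _ _ => Nat.zero_le _) (Finset.mem_univ i)
  simp only [Pi.zero_apply]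
  omega

/-- Both sides count pairs of a `k`-subset and an element outside it. Truncated subtraction is
harmless since `d.choose k = 0` when `d < k`. -/
theorem mul_choose_pred (d k : ℕ) : d * (d - 1).choose k = (d - k) * d.choose k := by
  cases d with
  | zero => simp
  | succ d =>
    have := Nat.choose_mul_succ_eq d k
    rw [Nat.add_sub_cancel, mul_comm, this, mul_comm]

/-- Double counting of the pairs of a team and a non-boss outside it, carried out department by
department. -/
theorem sum_shrunkTeamCount (s : Department T → ℕ) (S : State T) :
    ∑ v ∈ S.1.erase ⊥, S.shrunkTeamCount s v = (S.size - 1 - ∑ i, s i) * S.teamCount s := by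
  have key (i : Department T) : ∑ v ∈ S.1.filter (fun v => v ∈ i.1), S.shrunkTeamCount s v =
      (S.deptSize i - s i) * S.teamCount s := by
    have h (v : T) (hv : v ∈ S.1.filter (fun v => v ∈ i.1)) : S.shrunkTeamCount s v =
        (S.deptSize i - 1).choose (s i) *
          ∏ j ∈ Finset.univ.erase i, (S.deptSize j).choose (s j) := by
      have hvi := (Finset.mem_filter.mp hv).2
      rw [State.shrunkTeamCount, ← Finset.mul_prod_erase _ _ (Finset.mem_univ i), if_pos hvi]
      congr 1
      refine Finset.prod_congr rfl fun j hj => ?_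
      rw [if_neg, Nat.sub_zero]
      intro hvj
      have hv0 : v ≠ ⊥ := by
        rintro rfl
        exact bot_notMem_department i hvi
      exact Finset.ne_of_mem_erase hj ((existsUnique_department hv0).unique hvj hvi)
    rw [Finset.sum_congr rfl h, Finset.sum_const, smul_eq_mul, State.teamCount,
      ← Finset.mul_prod_erase _ _ (Finset.mem_univ i), ← mul_assoc, ← mul_assoc]
    congr 1
    exact mul_choose_pred _ _
  rw [← sum_departments, Finset.sum_congr rfl fun i _ => key i, ← Finset.sum_mul]
  -- The sum of the truncated differences is the difference of the sums only if every `s i` fits in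
  -- its department; otherwise there are no teams.
  by_cases h0 : S.teamCount s = 0
  · simp [h0]
  · rw [Finset.sum_tsub_distrib _ fun i _ => (teamCount_ne_zero_iff s S).mp h0 i, sum_deptSize]

/-- The deleted position `w` lies in the same department as `v`, so the count depends on `v` alone
and not on the course of the cascade. -/
theorem teamCount_of_eq_erase (s : Department T → ℕ) {S S' : State T} {v w : T} (hv : v ≠ ⊥)
    (hvw : v ≤ w) (hw : w ∈ S.1) (h : S'.1 = S.1.erase w) :
    S'.teamCount s = S.shrunkTeamCount s v := by
  refine Finset.prod_congr rfl fun i _ => ?_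
  congr 1
  simp only [State.deptSize, h, Finset.filter_erase, ← mem_department_iff_of_le hv hvw i]
  split_ifs with hi
  · rw [Finset.card_erase_of_mem (Finset.mem_filter.mpr ⟨hw, hi⟩)]
  · rw [Finset.erase_eq_of_notMem fun h' => hi (Finset.mem_filter.mp h').2, Nat.sub_zero]

theorem deptSize_le_full (S : State T) (i : Department T) :
    S.deptSize i ≤ (State.full T).deptSize i :=
  Finset.card_le_card (Finset.filter_subset_filter _ (Finset.subset_univ _))

theorem size_le_full (S : State T) : S.size ≤ (State.full T).size :=
  Finset.card_le_card (Finset.subset_univ _)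

end Teams

/-! ### Promotion cascades: which department loses a position -/

section Cascades

open Classical

variable {T : RootedTree} [Fintype T]

/-- The employees holding a position. -/
noncomputable def employees (pos : T → Option T) : Finset T :=
  Finset.univ.filter (fun e => ∃ v, pos e = some v)

theorem mem_employees {pos : T → Option T} {e : T} : e ∈ employees pos ↔ ∃ v, pos e = some v := by
  simp [employees]

theorem mem_occupied {pos : T → Option T} {v : T} : v ∈ occupied pos ↔ ∃ e, pos e = some v := by
  simp [occupied]

/-- Summation over the employees is summation over the positions they hold. -/
theorem sum_employees {M : Type*} [AddCommMonoid M] {pos : T → Option T}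
    (inj : ∀ e e' v, pos e = some v → pos e' = some v → e = e') {h g : T → M}
    (hg : ∀ e v, pos e = some v → g e = h v) :
    ∑ e ∈ employees pos, g e = ∑ v ∈ occupied pos, h v := by
  refine Finset.sum_bij (fun e he => (mem_employees.mp he).choose) ?_ ?_ ?_ ?_
  · exact fun e he => mem_occupied.mpr ⟨e, (mem_employees.mp he).choose_spec⟩
  · intro e he e' he' heq
    exact inj e e' _ (mem_employees.mp he).choose_spec
      (by rw [(mem_employees.mp he').choose_spec, heq])
  · intro v hv
    obtain ⟨e, he⟩ := mem_occupied.mp hv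
    refine ⟨e, mem_employees.mpr ⟨v, he⟩, ?_⟩
    have := (mem_employees.mp (mem_employees.mpr ⟨v, he⟩ : e ∈ employees pos)).choose_spec
    exact Option.some.inj (this.symm.trans he)
  · exact fun e he => hg e _ (mem_employees.mp he).choose_spec

theorem card_employees {pos : T → Option T}
    (inj : ∀ e e' v, pos e = some v → pos e' = some v → e = e') :
    (employees pos).card = (occupied pos).card := by
  simpa only [Finset.card_eq_sum_ones] using
    sum_employees inj (h := fun _ => 1) (g := fun _ => 1) fun _ _ _ => rfl

theorem Staffing.card_employees_eq_size (ρ : Staffing T) :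
    (employees ρ.pos).card = ρ.state.size :=
  card_employees ρ.inj

/-- The company structure of a vacancy, the vacant position included. -/
noncomputable def Vacancy.structure (c : Vacancy T) : State T :=
  ⟨insert c.spot (occupied c.pos), c.rooted⟩

theorem Vacancy.spot_notMem (c : Vacancy T) : c.spot ∉ occupied c.pos := fun h => by
  obtain ⟨e, he⟩ := mem_occupied.mp h
  exact c.vacant e he

theorem Vacancy.mem_candidates {c : Vacancy T} {e : T} :
    e ∈ c.candidates ↔ ∃ w, c.pos e = some w ∧ c.spot < w := by
  simp [Vacancy.candidates]

theorem Vacancy.promote_spot (c : Vacancy T) {e v : T} (he : e ∈ c.candidates)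
    (hv : c.pos e = some v) : (c.promote e he).spot = v := by
  simp [Vacancy.promote, hv]

theorem Vacancy.structure_promote (c : Vacancy T) {e : T} (he : e ∈ c.candidates) :
    (c.promote e he).structure = c.structure := by
  refine Subtype.ext (Finset.ext fun x => ?_)
  obtain ⟨w, hw, -⟩ := mem_candidates.mp he
  simp only [Vacancy.structure, promote, Finset.mem_insert, mem_occupied, exists_update_iff, hw,
    Option.get_some]
  constructor
  · rintro (rfl | rfl | ⟨e', -, h⟩)
    · exact Or.inr ⟨e, hw⟩
    · exact Or.inl rfl
    · exact Or.inr ⟨e', h⟩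
  · rintro (rfl | ⟨e', h⟩)
    · exact Or.inr (Or.inl rfl)
    · by_cases hee : e' = e
      · subst hee
        rw [hw] at h
        exact Or.inl (Option.some.inj h).symm
      · exact Or.inr (Or.inr ⟨e', hee, h⟩)

theorem Vacancy.employees_promote (c : Vacancy T) {e : T} (he : e ∈ c.candidates) :
    employees (c.promote e he).pos = employees c.pos := by
  ext x
  obtain ⟨w, hw, -⟩ := mem_candidates.mp he
  simp only [promote, mem_employees]
  by_cases hx : x = e
  · subst hx
    simp [hw]
  · simp [hx]

/-- A cascade deletes one position, at or below the vacant one, and keeps the employees. -/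
theorem exists_of_mem_support_cascade (c : Vacancy T) {τ : Staffing T}
    (hτ : τ ∈ (cascade c).support) :
    employees τ.pos = employees c.pos ∧
      ∃ w, c.spot ≤ w ∧ w ∈ c.structure.1 ∧ τ.state.1 = c.structure.1.erase w := by
  induction c using cascade.induct with
  | case1 c h ih =>
    rw [cascade, dif_pos h, PMF.mem_support_bind_iff] at hτ
    obtain ⟨e, -, he⟩ := hτ
    obtain ⟨h1, w, h2, h3, h4⟩ := ih e he
    rw [c.employees_promote] at h1
    rw [c.structure_promote] at h3 h4
    exact ⟨h1, w, (c.spot_lt_of_mem e.2).le.trans h2, h3, h4⟩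
  | case2 c h =>
    rw [cascade, dif_neg h, PMF.mem_support_pure_iff] at hτ
    subst hτ
    exact ⟨rfl, c.spot, le_rfl, Finset.mem_insert_self _ _,
      (Finset.erase_insert c.spot_notMem).symm⟩

/-- The count is constant on the support of the cascade, since the vacancy never leaves its
department. -/
theorem mean_teamCount_cascade_of_ne_bot (s : Department T → ℕ) (c : Vacancy T)
    (hc : c.spot ≠ ⊥) :
    mean (cascade c) (fun τ => (τ.state.teamCount s : ℝ≥0∞)) =
      c.structure.shrunkTeamCount s c.spot := by
  rw [← mean_const (cascade c) (c.structure.shrunkTeamCount s c.spot : ℝ≥0∞)]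
  refine mean_congr fun τ hτ => ?_
  obtain ⟨-, w, h1, h2, h3⟩ := exists_of_mem_support_cascade c hτ
  rw [teamCount_of_eq_erase s hc h1 h2 h3]

/-- Everyone left is a candidate for the boss's position, so the first promotion vacates a uniformly
random non-boss position; from there on the count is deterministic. -/
theorem mean_teamCount_cascade_of_eq_bot (s : Department T → ℕ) (c : Vacancy T)
    (hc : c.spot = ⊥) :
    ((c.structure.size - 1 : ℕ) : ℝ≥0∞) *
        mean (cascade c) (fun τ => (τ.state.teamCount s : ℝ≥0∞)) =
      ∑ v ∈ c.structure.1.erase ⊥, (c.structure.shrunkTeamCount s v : ℝ≥0∞) := by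
  have hocc : c.structure.1.erase ⊥ = occupied c.pos := by
    rw [Vacancy.structure, ← hc, Finset.erase_insert c.spot_notMem]
  have hcand : c.candidates = employees c.pos := by
    ext e
    rw [Vacancy.mem_candidates, mem_employees, hc]
    refine exists_congr fun v => and_iff_left_of_imp fun hv => bot_lt_iff_ne_bot.mpr ?_
    rintro rfl
    exact c.vacant e (hc ▸ hv)
  have hne : c.candidates.Nonempty := by
    obtain ⟨e, he⟩ := c.staffed
    exact ⟨e, hcand ▸ mem_employees.mpr he⟩
  have hcard : c.structure.size - 1 = c.candidates.attach.card := by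
    rw [Finset.card_attach, hcand, card_employees c.inj, ← hocc,
      Finset.card_erase_of_mem c.structure.2.1]
    rfl
  rw [cascade, dif_pos hne, mean_bind, hcard, mean_uniformOfFinset]
  have key (e : T) (he : e ∈ c.candidates) (v : T) (hv : c.pos e = some v) :
      mean (cascade (c.promote e he)) (fun τ => (τ.state.teamCount s : ℝ≥0∞)) =
        c.structure.shrunkTeamCount s v := by
    have hspot := c.promote_spot he hv
    rw [mean_teamCount_cascade_of_ne_bot, c.structure_promote, hspot]
    have := c.spot_lt_of_mem he
    simp only [hv, Option.get_some] at this
    rw [hspot]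
    exact this.ne_bot
  -- The value `0` is a dummy: by `hcand` every employee is a candidate.
  rw [hocc, ← sum_employees c.inj (g := fun e =>
    if he : e ∈ c.candidates then
      mean (cascade (c.promote e he)) (fun τ => (τ.state.teamCount s : ℝ≥0∞)) else 0)]
  · rw [← hcand, ← Finset.sum_attach c.candidates]
    exact Finset.sum_congr rfl fun e _ => by rw [dif_pos e.2]
  · intro e v hv
    have he : e ∈ c.candidates := hcand ▸ mem_employees.mpr ⟨v, hv⟩
    rw [dif_pos he, key e he v hv]

/-! ### Firing one employee -/

theorem Staffing.structure_dismiss (ρ : Staffing T) {e v : T} (hev : ρ.pos e = some v)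
    (h : 1 < ρ.state.size) : (ρ.dismiss e v hev h).structure = ρ.state := by
  refine Subtype.ext (Finset.ext fun x => ?_)
  simp only [Vacancy.structure, dismiss, Finset.mem_insert, mem_occupied, Staffing.state]
  constructor
  · rintro (rfl | ⟨e', h'⟩)
    · exact ⟨e, hev⟩
    · have k : e' ≠ e := by
        rintro rfl
        simp at h'
      exact ⟨e', by simpa [k] using h'⟩
  · rintro ⟨e', h'⟩
    by_cases k : e' = e
    · subst k
      rw [hev] at h'
      exact Or.inl (Option.some.inj h').symm
    · exact Or.inr ⟨e', by simpa [k] using h'⟩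

theorem Staffing.employees_dismiss (ρ : Staffing T) {e v : T} (hev : ρ.pos e = some v)
    (h : 1 < ρ.state.size) :
    employees (ρ.dismiss e v hev h).pos = (employees ρ.pos).erase e := by
  ext x
  simp only [dismiss, mem_employees, Finset.mem_erase]
  by_cases hx : x = e
  · simp [hx]
  · simp [hx]

theorem fire_eq_cascade (ρ : Staffing T) {e v : T} (hev : ρ.pos e = some v)
    (h : 1 < ρ.state.size) : fire ρ e = cascade (ρ.dismiss e v hev h) := by
  have h' : (∃ v, ρ.pos e = some v) ∧ 1 < ρ.state.size := ⟨⟨v, hev⟩, h⟩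
  rw [fire, dif_pos h']
  have hv : h'.1.choose = v := Option.some.inj (h'.1.choose_spec.symm.trans hev)
  congr 2

theorem fire_eq_pure (ρ : Staffing T) (e : T) (h : ρ.state.size ≤ 1) : fire ρ e = PMF.pure ρ := by
  rw [fire, dif_neg fun h' => h'.2.not_ge h]

/-- Tracking employees rather than positions ensures that those still to be fired remain well
defined after promotions. -/
theorem employees_of_mem_support_fire {ρ τ : Staffing T} {e : T} (he : e ∈ employees ρ.pos)
    (h : 1 < ρ.state.size) (hτ : τ ∈ (fire ρ e).support) :
    employees τ.pos = (employees ρ.pos).erase e := by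
  obtain ⟨v, hv⟩ := mem_employees.mp he
  rw [fire_eq_cascade ρ hv h] at hτ
  rw [(exists_of_mem_support_cascade _ hτ).1, ρ.employees_dismiss hv h]

theorem size_of_mem_support_fire {ρ τ : Staffing T} {e : T} (he : e ∈ employees ρ.pos)
    (h : 1 < ρ.state.size) (hτ : τ ∈ (fire ρ e).support) :
    τ.state.size = ρ.state.size - 1 := by
  rw [← τ.card_employees_eq_size, employees_of_mem_support_fire he h hτ,
    Finset.card_erase_of_mem he, ρ.card_employees_eq_size]

/-- The total weight after firing each of the employees in turn. -/
theorem sum_mean_weight_fire (s : Department T → ℕ) (ρ : Staffing T) (h : 1 < ρ.state.size) :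
    ∑ e ∈ employees ρ.pos, mean (fire ρ e) (fun τ => (τ.state.weight s : ℝ≥0∞)) =
      ((ρ.state.size - 1 - ∑ i, s i : ℕ) : ℝ≥0∞) * ρ.state.weight s := by
  have hfire (e v : T) (hv : ρ.pos e = some v) :
      mean (fire ρ e) (fun τ => (τ.state.weight s : ℝ≥0∞)) =
        if v = ⊥ then ∑ v ∈ ρ.state.1.erase ⊥, (ρ.state.shrunkTeamCount s v : ℝ≥0∞)
        else ((ρ.state.size - 1 : ℕ) : ℝ≥0∞) * ρ.state.shrunkTeamCount s v := by
    have h1 : mean (fire ρ e) (fun τ => (τ.state.weight s : ℝ≥0∞)) =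
        ((ρ.state.size - 1 : ℕ) : ℝ≥0∞) *
          mean (fire ρ e) (fun τ => (τ.state.teamCount s : ℝ≥0∞)) := by
      rw [← mean_mul_left]
      refine mean_congr fun τ hτ => ?_
      rw [State.weight, size_of_mem_support_fire (mem_employees.mpr ⟨v, hv⟩) h hτ, Nat.cast_mul]
    rw [h1, fire_eq_cascade ρ hv h]
    split_ifs with hb
    · have := mean_teamCount_cascade_of_eq_bot s (ρ.dismiss e v hv h) hb
      rwa [ρ.structure_dismiss] at this
    · have := mean_teamCount_cascade_of_ne_bot s (ρ.dismiss e v hv h) hb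
      rw [ρ.structure_dismiss] at this
      rw [this]
      rfl
  rw [sum_employees ρ.inj hfire]
  change ∑ v ∈ ρ.state.1, _ = _
  rw [← Finset.add_sum_erase _ _ ρ.state.2.1, if_pos rfl,
    Finset.sum_congr rfl fun v hv => if_neg (Finset.ne_of_mem_erase hv), ← Finset.mul_sum,
    ← Nat.cast_sum, sum_shrunkTeamCount, State.weight]
  norm_cast
  -- With `n = 1 + m + 1`, the boss contributes once and the other employees `m + 1` times the same
  -- total, which adds up to the factor `n` of the weight.
  obtain ⟨m, hm⟩ := Nat.exists_eq_add_of_lt h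
  rw [hm]
  simp only [Nat.add_assoc, Nat.add_sub_cancel_left]
  ring

end Cascades

/-! ### Random sets of employees and firing them in random order -/

section Months

open Classical

/-- Choosing a set of `k + 1` elements and one of them is choosing an element and `k` others. -/
theorem sum_powersetCard_succ {α M : Type*} [DecidableEq α] [AddCommMonoid M] (A : Finset α)
    (k : ℕ) (h : α → Finset α → M) :
    ∑ F ∈ A.powersetCard (k + 1), ∑ e ∈ F, h e (F.erase e) =
      ∑ e ∈ A, ∑ G ∈ (A.erase e).powersetCard k, h e G := by
  rw [Finset.sum_sigma', Finset.sum_sigma']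
  refine Finset.sum_bij' (fun x _ => ⟨x.2, x.1.erase x.2⟩) (fun x _ => ⟨insert x.1 x.2, x.1⟩)
    ?_ ?_ ?_ ?_ ?_
  · rintro ⟨F, e⟩ hx
    simp only [Finset.mem_sigma, Finset.mem_powersetCard] at hx ⊢
    obtain ⟨⟨hF, hk⟩, he⟩ := hx
    exact ⟨hF he, Finset.erase_subset_erase _ hF, by rw [Finset.card_erase_of_mem he, hk]; rfl⟩
  · rintro ⟨e, G⟩ hx
    simp only [Finset.mem_sigma, Finset.mem_powersetCard] at hx ⊢
    obtain ⟨he, hG, hk⟩ := hx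
    have heG : e ∉ G := fun h' => Finset.notMem_erase e A (hG h')
    refine ⟨⟨Finset.insert_subset he (hG.trans (Finset.erase_subset _ _)), ?_⟩,
      Finset.mem_insert_self _ _⟩
    rw [Finset.card_insert_of_notMem heG, hk]
  · rintro ⟨F, e⟩ hx
    simp only [Finset.mem_sigma] at hx
    simp [Finset.insert_erase hx.2]
  · rintro ⟨e, G⟩ hx
    simp only [Finset.mem_sigma, Finset.mem_powersetCard] at hx
    have heG : e ∉ G := fun h' => Finset.notMem_erase e A (hx.2.1 h')
    simp [Finset.erase_insert heG]
  · exact fun _ _ => rfl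

theorem mean_randomSubset {T : RootedTree} (p : I) (A : Finset T) (g : Finset T → ℝ≥0∞) :
    mean (randomSubset p A) g = ∑ k ∈ Finset.range (A.card + 1),
      ENNReal.ofReal p ^ k * ENNReal.ofReal (1 - p) ^ (A.card - k) *
        ∑ F ∈ A.powersetCard k, g F := by
  rw [mean, tsum_eq_sum (s := A.powerset), Finset.sum_powerset]
  · refine Finset.sum_congr rfl fun k _ => ?_
    rw [Finset.mul_sum]
    refine Finset.sum_congr rfl fun F hF => ?_
    obtain ⟨h1, h2⟩ := Finset.mem_powersetCard.mp hF
    rw [randomSubset, PMF.ofFinset_apply, if_pos h1, h2]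
  · intro F hF
    rw [randomSubset, PMF.ofFinset_apply, if_neg fun h => hF (Finset.mem_powerset.mpr h), zero_mul]

variable {T : RootedTree} [Fintype T]

theorem mean_fireAll (F : Finset T) (ρ : Staffing T) (g : Staffing T → ℝ≥0∞) (hF : F.Nonempty) :
    (F.card : ℝ≥0∞) * mean (fireAll F ρ) g =
      ∑ e ∈ F, mean (fire ρ e) fun τ => mean (fireAll (F.erase e) τ) g := by
  rw [fireAll, dif_pos hF, mean_bind, ← Finset.card_attach, mean_uniformOfFinset]
  simp only [mean_bind]
  exact Finset.sum_attach F fun e => mean (fire ρ e) fun τ => mean (fireAll (F.erase e) τ) g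

theorem fireAll_empty (ρ : Staffing T) : fireAll ∅ ρ = PMF.pure ρ := by
  rw [fireAll, dif_neg Finset.not_nonempty_empty]

theorem fireAll_eq_pure (F : Finset T) (ρ : Staffing T) (h : ρ.state.size ≤ 1) :
    fireAll F ρ = PMF.pure ρ := by
  induction F using Finset.strongInduction with
  | H F ih =>
    rw [fireAll]
    split_ifs with hF
    · have key (e : {x // x ∈ F}) :
          ((fire ρ e.1).bind fun τ => fireAll (F.erase e.1) τ) = PMF.pure ρ := by
        rw [fire_eq_pure ρ e.1 h, PMF.pure_bind, ih _ (Finset.erase_ssubset e.2)]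
      simp only [key, PMF.bind_const]
    · rfl

/-- The total weight after firing, for each set of `k` employees, all employees in that set. -/
theorem sum_mean_weight_fireAll {s : Department T → ℕ} (hs : s ≠ 0) (k : ℕ) (ρ : Staffing T) :
    ∑ F ∈ (employees ρ.pos).powersetCard k,
        mean (fireAll F ρ) (fun τ => (τ.state.weight s : ℝ≥0∞)) =
      ((ρ.state.size - 1 - ∑ i, s i).choose k : ℝ≥0∞) * ρ.state.weight s := by
  induction k generalizing ρ with
  | zero => simp [fireAll_empty]
  | succ k ih =>
    by_cases h : 1 < ρ.state.size
    -- Multiplying by `k + 1` clears the probability that a given member of the set is fired first.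
    · have hk : ((k + 1 : ℕ) : ℝ≥0∞) ≠ 0 := by simp
      rw [← ENNReal.mul_right_inj hk (ENNReal.natCast_ne_top _), Finset.mul_sum]
      have h1 (F : Finset T) (hF : F ∈ (employees ρ.pos).powersetCard (k + 1)) :
          ((k + 1 : ℕ) : ℝ≥0∞) * mean (fireAll F ρ) (fun τ => (τ.state.weight s : ℝ≥0∞)) =
            ∑ e ∈ F, mean (fire ρ e) fun τ =>
              mean (fireAll (F.erase e) τ) (fun τ => (τ.state.weight s : ℝ≥0∞)) := by
        have hc := (Finset.mem_powersetCard.mp hF).2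
        rw [← mean_fireAll, hc]
        exact Finset.card_pos.mp (by omega)
      rw [Finset.sum_congr rfl h1, sum_powersetCard_succ _ _ fun e G =>
        mean (fire ρ e) fun τ => mean (fireAll G τ) (fun τ => (τ.state.weight s : ℝ≥0∞))]
      have h2 (e : T) (he : e ∈ employees ρ.pos) :
          ∑ G ∈ ((employees ρ.pos).erase e).powersetCard k, (mean (fire ρ e) fun τ =>
              mean (fireAll G τ) (fun τ => (τ.state.weight s : ℝ≥0∞))) =
            ((ρ.state.size - 1 - 1 - ∑ i, s i).choose k : ℝ≥0∞) *
              mean (fire ρ e) (fun τ => (τ.state.weight s : ℝ≥0∞)) := by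
        rw [← mean_sum, ← mean_mul_left]
        -- After `e` is fired the employees are exactly the others, so the induction hypothesis
        -- applies to each outcome `τ`.
        refine mean_congr fun τ hτ => ?_
        rw [← employees_of_mem_support_fire he h hτ, ih τ, size_of_mem_support_fire he h hτ]
      rw [Finset.sum_congr rfl h2, ← Finset.mul_sum, sum_mean_weight_fire s ρ h, ← mul_assoc,
        ← mul_assoc]
      congr 1
      norm_cast
      rw [Nat.sub_right_comm]
      -- With `M = n - 1 - ∑ i, s i`, what remains is `choose (M - 1) k * M = (k + 1) * choose M (k
      -- + 1)`; the case `M = 0` is separate because of `M - 1`.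
      rcases Nat.eq_zero_or_pos (ρ.state.size - 1 - ∑ i, s i) with h0 | h0
      · simp [h0]
      · obtain ⟨m, hm⟩ := Nat.exists_eq_add_of_lt h0
        rw [hm, zero_add, Nat.add_sub_cancel, mul_comm, Nat.add_one_mul_choose_eq, mul_comm]
    · have h0 := teamCount_eq_zero_of_size_le_one hs (not_lt.mp h)
      simp [fireAll_eq_pure _ ρ (not_lt.mp h), State.weight, h0]

/-! ### One month of the binomial model -/

theorem state_staffing (S : State T) : S.staffing.state = S := by
  refine Subtype.ext (Finset.ext fun x => ?_)
  simp [Staffing.state, State.staffing, mem_occupied]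

theorem employees_staffing (S : State T) : employees S.staffing.pos = S.1 := by
  ext x
  simp [State.staffing, mem_employees]

theorem mean_weight_binomial {s : Department T → ℕ} (hs : s ≠ 0) (q : I) (S : State T) :
    mean (binomial q S) (fun S' => (S'.weight s : ℝ≥0∞)) =
      ENNReal.ofReal q ^ (1 + ∑ i, s i) * S.weight s := by
  have hkey (k : ℕ) : ∑ F ∈ S.1.powersetCard k,
      mean (fireAll F S.staffing) (fun τ => (τ.state.weight s : ℝ≥0∞)) =
        ((S.size - 1 - ∑ i, s i).choose k : ℝ≥0∞) * S.weight s := by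
    have := sum_mean_weight_fireAll hs k S.staffing
    rwa [employees_staffing, state_staffing] at this
  simp only [binomial, mean_bind, mean_map, mean_randomSubset, hkey, ← mul_assoc]
  rw [← Finset.sum_mul]
  by_cases h0 : S.teamCount s = 0
  · simp [State.weight, h0]
  · congr 1
    obtain ⟨m, hm⟩ := Nat.exists_eq_add_of_le (sum_lt_size_of_teamCount_ne_zero h0)
    have hm' : S.size - 1 - ∑ i, s i = m := by omega
    -- The terms with `k > m` vanish, as `m.choose k = 0`.
    have hsub : Finset.range (m + 1) ⊆ Finset.range (S.1.card + 1) := by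
      refine Finset.range_subset_range.mpr ?_
      have : S.1.card = S.size := rfl
      omega
    have hq : (1 : ℝ) - (unitInterval.symm q : ℝ) = q := by simp
    rw [hm', hq, ← Finset.sum_subset hsub]
    · have hone : ENNReal.ofReal (unitInterval.symm q : ℝ) + ENNReal.ofReal (q : ℝ) = 1 := by
        rw [← ENNReal.ofReal_add (unitInterval.symm q).2.1 q.2.1]
        simp
      -- The binomial expansion of `1 = ((1 - q) + q) ^ m` absorbs everything but `q ^ (1 + ∑ i, s
      -- i)`, because `n - k = (1 + ∑ i, s i) + (m - k)`.
      have hpow := add_pow (ENNReal.ofReal (unitInterval.symm q : ℝ)) (ENNReal.ofReal (q : ℝ)) m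
      rw [hone, one_pow] at hpow
      rw [← mul_one (ENNReal.ofReal (q : ℝ) ^ _), hpow, Finset.mul_sum]
      refine Finset.sum_congr rfl fun k hk => ?_
      have hk' : S.1.card - k = (1 + ∑ i, s i) + (m - k) := by
        have : S.1.card = S.size := rfl
        have := Finset.mem_range.mp hk
        omega
      rw [hk', pow_add]
      ring
    · intro k _ hk
      rw [Finset.mem_range, not_lt] at hk
      rw [Nat.choose_eq_zero_of_lt (by omega), Nat.cast_zero, mul_zero]

/-! ### One month of the single model -/

theorem mean_coin (p : I) (g : Bool → ℝ≥0∞) :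
    mean (coin p) g = ENNReal.ofReal p * g true + ENNReal.ofReal (1 - p) * g false := by
  simp [mean, tsum_fintype, coin]

/-- Firing a uniformly chosen employee, on average. -/
theorem mean_weight_fire_uniform {s : Department T → ℕ} (hs : s ≠ 0) (S : State T) :
    (mean (PMF.uniformOfFinset S.1 ⟨⊥, S.2.1⟩) fun e =>
        mean (fire S.staffing e) fun τ => (τ.state.weight s : ℝ≥0∞)) =
      ((S.size - 1 - ∑ i, s i : ℕ) : ℝ≥0∞) * S.teamCount s := by
  have hn : (S.size : ℝ≥0∞) ≠ 0 := by exact_mod_cast (size_pos S).ne'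
  rw [← ENNReal.mul_right_inj hn (ENNReal.natCast_ne_top _)]
  refine (mean_uniformOfFinset S.1 ⟨⊥, S.2.1⟩ _).trans ?_
  by_cases h : 1 < S.size
  · have := sum_mean_weight_fire s S.staffing (by rwa [state_staffing])
    rw [employees_staffing, state_staffing] at this
    rw [this, State.weight, Nat.cast_mul]
    ring
  · have h0 := teamCount_eq_zero_of_size_le_one hs (not_lt.mp h)
    have h1 (e : T) : fire S.staffing e = PMF.pure S.staffing :=
      fire_eq_pure _ e (by rw [state_staffing]; exact not_lt.mp h)
    simp [h1, state_staffing, State.weight, h0]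

/-- Firing contributes `(n - 1 - ∑ sᵢ) / n₀` times the weight and the idle month `(n₀ - n) / n₀`
times it, so `n` cancels from the eigenvalue. -/
theorem expect_weight_single {s : Department T → ℕ} (hs : s ≠ 0) (S : State T) :
    expect (single S) (fun S' => (S'.weight s : ℝ)) =
      (((State.full T).size : ℝ) - 1 - ∑ i, (s i : ℝ)) / (State.full T).size * S.weight s := by
  have hp := size_ratio_mem S
  have hn0 : ((State.full T).size : ℝ) ≠ 0 := by exact_mod_cast (size_pos (State.full T)).ne'
  rw [expect_eq_toReal_mean, single, mean_bind, mean_coin]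
  simp only [if_true, Bool.false_eq_true, if_false, mean_pure, mean_bind, mean_map]
  rw [mean_weight_fire_uniform hs, ENNReal.toReal_add, ENNReal.toReal_mul, ENNReal.toReal_mul,
    ENNReal.toReal_mul, ENNReal.toReal_ofReal hp.1, ENNReal.toReal_ofReal (sub_nonneg.mpr hp.2)]
  · simp only [ENNReal.toReal_natCast]
    by_cases h0 : S.teamCount s = 0
    · simp [State.weight, h0]
    -- A team exists, so the truncated `n - 1 - ∑ i, s i` is the true difference.
    · obtain ⟨m, hm⟩ := Nat.exists_eq_add_of_le (sum_lt_size_of_teamCount_ne_zero h0)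
      have hm' : S.size - 1 - ∑ i, s i = m := by omega
      rw [hm', State.weight, Nat.cast_mul, hm]
      push_cast
      field_simp
      ring
  · exact ENNReal.mul_ne_top ENNReal.ofReal_ne_top
      (ENNReal.mul_ne_top (ENNReal.natCast_ne_top _) (ENNReal.natCast_ne_top _))
  · exact ENNReal.mul_ne_top ENNReal.ofReal_ne_top (ENNReal.natCast_ne_top _)

theorem expect_weight_binomial {s : Department T → ℕ} (hs : s ≠ 0) (q : I) (S : State T) :
    expect (binomial q S) (fun S' => (S'.weight s : ℝ)) =
      (q : ℝ) ^ (1 + ∑ i, s i) * S.weight s := by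
  rw [expect_eq_toReal_mean, mean_weight_binomial hs, ENNReal.toReal_mul, ENNReal.toReal_pow,
    ENNReal.toReal_ofReal q.2.1, ENNReal.toReal_natCast]

/-- In the single model at most one employee leaves each month. -/
theorem size_le_of_mem_support_single {S S' : State T} (h : S' ∈ (single S).support) :
    S.size ≤ S'.size + 1 := by
  rw [single, PMF.mem_support_bind_iff] at h
  obtain ⟨b, -, hb⟩ := h
  cases b with
  | false =>
    simp only [Bool.false_eq_true, if_false, PMF.mem_support_pure_iff] at hb
    rw [hb]
    exact Nat.le_succ _
  | true =>
    simp only [if_true, PMF.mem_support_bind_iff, PMF.mem_support_map_iff] at hb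
    obtain ⟨e, he, τ, hτ, rfl⟩ := hb
    replace he := (PMF.mem_support_uniformOfFinset_iff ⟨⊥, S.2.1⟩ e).mp he
    by_cases h1 : 1 < S.size
    · have := size_of_mem_support_fire (ρ := S.staffing) (by rwa [employees_staffing])
        (by rwa [state_staffing]) hτ
      rw [state_staffing] at this
      omega
    · rw [fire_eq_pure _ e (by rw [state_staffing]; omega), PMF.mem_support_pure_iff] at hτ
      rw [hτ, state_staffing]
      exact Nat.le_succ _

theorem size_le_of_mem_support_law_single {S S' : State T} {t : ℕ}
    (h : S' ∈ (law single S t).support) : S.size ≤ S'.size + t := by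
  induction t generalizing S' with
  | zero =>
    rw [law, PMF.mem_support_pure_iff] at h
    rw [h]
    exact Nat.le_refl _
  | succ t ih =>
    rw [law, PMF.mem_support_bind_iff] at h
    obtain ⟨x, hx, hx'⟩ := h
    have := ih hx
    have := size_le_of_mem_support_single hx'
    omega

/-- Bounds on the number of teams, for any distribution. -/
theorem expect_teams_bounds (s : Department T → ℕ) (p : PMF (State T)) :
    expect p (fun S => (S.weight s : ℝ)) / (State.full T).size ≤ expect p (State.teams s) ∧
      expect p (State.teams s) ≤
        expect p (fun S => (S.weight s : ℝ)) / (1 + ∑ i, (s i : ℝ)) := by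
  have hn0 : (0 : ℝ) < (State.full T).size := by exact_mod_cast size_pos (State.full T)
  have hpos : (0 : ℝ) < 1 + ∑ i, (s i : ℝ) := by positivity
  rw [div_le_iff₀ hn0, le_div_iff₀ hpos, mul_comm _ (((State.full T).size : ℝ)),
    mul_comm _ (1 + ∑ i, (s i : ℝ)), ← expect_const_mul, ← expect_const_mul]
  refine ⟨expect_mono fun S _ => ?_, expect_mono fun S _ => ?_⟩
  · rw [teams_eq_teamCount]
    exact_mod_cast Nat.mul_le_mul_right _ (size_le_full S)
  · rw [teams_eq_teamCount]
    by_cases h0 : S.teamCount s = 0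
    · simp [State.weight, h0]
    · exact_mod_cast Nat.mul_le_mul_right _ (sum_lt_size_of_teamCount_ne_zero h0)

/-- At least `n₀ - t` employees remain almost surely, so the weight is at least `n₀ - t` times the
number of teams. -/
theorem expect_teams_law_single_le (s : Department T → ℕ) (t : ℕ)
    (ht : (t : ℝ) < (State.full T).size) :
    expect (law single (State.full T) t) (State.teams s) ≤
      expect (law single (State.full T) t) (fun S => (S.weight s : ℝ)) /
        ((State.full T).size - t) := by
  rw [le_div_iff₀ (sub_pos.mpr ht), mul_comm, ← expect_const_mul]
  refine expect_mono fun S hS => ?_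
  have h : ((State.full T).size : ℝ) ≤ S.size + t := by
    exact_mod_cast size_le_of_mem_support_law_single hS
  rw [teams_eq_teamCount, State.weight, Nat.cast_mul]
  exact mul_le_mul_of_nonneg_right (by linarith) (Nat.cast_nonneg _)

/-- Department sizes are largest in the full tree, so if the weight is nonzero anywhere it is
nonzero there. -/
theorem weight_ne_zero_iff (s : Department T → ℕ) :
    (fun S : State T => (S.weight s : ℝ)) ≠ 0 ↔ ∀ i, s i ≤ (State.full T).deptSize i := by
  rw [Function.ne_iff]
  constructor
  · rintro ⟨S, hS⟩ i
    have h0 : S.teamCount s ≠ 0 := by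
      intro h
      simp [State.weight, h] at hS
    exact ((teamCount_ne_zero_iff s S).mp h0 i).trans (deptSize_le_full S i)
  · intro h
    refine ⟨State.full T, ?_⟩
    simpa [State.weight] using
      ⟨(size_pos (State.full T)).ne', (teamCount_ne_zero_iff s _).mpr h⟩

end Months

end Firing

open scoped unitInterval in
open Firing in
open Matrix in
theorem corollary5p4 (T₀ : RootedTree) [Fintype T₀] (q₂ : I)
    (s : Department T₀ → ℕ) (hs : s ≠ 0) :
    let n₀ : ℝ := ((State.full T₀).size : ℝ)
    let teams₀ : ℝ := (State.full T₀).teams s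
    let f : State T₀ → ℝ := fun S => (S.size : ℝ) * S.teams s
    let βsingle : ℝ := (n₀ - 1 - (∑ i, (s i : ℝ))) / n₀
    let βbinomial : ℝ := (q₂ : ℝ) ^ (1 + ∑ i, s i)
    -- the eigenfunction
    (transitionMatrix (single (T := T₀)) *ᵥ f = βsingle • f ∧
      transitionMatrix (binomial (T := T₀) q₂) *ᵥ f = βbinomial • f ∧
      (f ≠ 0 ↔ ∀ i, s i ≤ (State.full T₀).deptSize i)) ∧
    -- its expectation after `t` months
    (∀ t : ℕ,
      expect (law single (State.full T₀) t) f = βsingle ^ t * (n₀ * teams₀) ∧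
      expect (law (binomial q₂) (State.full T₀) t) f = βbinomial ^ t * (n₀ * teams₀)) ∧
    -- the bounds on the expected number of teams after `t` months
    (∀ t : ℕ,
      βsingle ^ t * teams₀ ≤ expect (law single (State.full T₀) t) (State.teams s) ∧
      expect (law single (State.full T₀) t) (State.teams s) ≤
        βsingle ^ t * (n₀ / (1 + ∑ i, (s i : ℝ))) * teams₀ ∧
      βbinomial ^ t * teams₀ ≤
        expect (law (binomial q₂) (State.full T₀) t) (State.teams s) ∧
      expect (law (binomial q₂) (State.full T₀) t) (State.teams s) ≤
        βbinomial ^ t * (n₀ / (1 + ∑ i, (s i : ℝ))) * teams₀) ∧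
    -- the additional bound for the single model
    (∀ t : ℕ, (t : ℝ) < n₀ →
      expect (law single (State.full T₀) t) (State.teams s) ≤
        βsingle ^ t * (n₀ / (n₀ - t)) * teams₀) := by
  intro n₀ teams₀ f βsingle βbinomial
  have hf : f = fun S => (S.weight s : ℝ) := by
    funext S
    simp only [f, State.weight, Nat.cast_mul, teams_eq_teamCount]
  have hn₀ : n₀ ≠ 0 := Nat.cast_ne_zero.mpr (size_pos (State.full T₀)).ne'
  have hsingle (S : State T₀) : expect (single S) f = βsingle * f S := by
    simpa only [hf] using expect_weight_single hs S
  have hbinomial (S : State T₀) : expect (binomial q₂ S) f = βbinomial * f S := by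
    simpa only [hf] using expect_weight_binomial hs q₂ S
  have esingle (t : ℕ) := expect_law_of_eigen hsingle (State.full T₀) t
  have ebinomial (t : ℕ) := expect_law_of_eigen hbinomial (State.full T₀) t
  refine ⟨⟨funext hsingle, funext hbinomial, hf ▸ weight_ne_zero_iff s⟩,
    fun t => ⟨esingle t, ebinomial t⟩, fun t => ?_, fun t ht => ?_⟩
  · have h1 := expect_teams_bounds s (law single (State.full T₀) t)
    have h2 := expect_teams_bounds s (law (binomial q₂) (State.full T₀) t)
    rw [← hf, esingle] at h1
    rw [← hf, ebinomial] at h2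
    -- Both rewritings rest on `f (State.full T₀) = n₀ * teams₀`, which holds by definition.
    have hlow (b : ℝ) : b * teams₀ = b * f (State.full T₀) / n₀ := by
      change _ = b * (n₀ * teams₀) / n₀
      field_simp
    have hup (b c : ℝ) : b * (n₀ / c) * teams₀ = b * f (State.full T₀) / c := by
      change _ = b * (n₀ * teams₀) / c
      ring
    exact ⟨(hlow _).trans_le h1.1, h1.2.trans_eq (hup _ _).symm,
      (hlow _).trans_le h2.1, h2.2.trans_eq (hup _ _).symm⟩
  · have h := expect_teams_law_single_le s t ht
    rw [← hf, esingle] at h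
    refine h.trans_eq ?_
    change βsingle ^ t * (n₀ * teams₀) / (n₀ - t) = _
    ring
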